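/- For $s>1$ let $D_s$ be the set of Borel probability measures $\mu$ on $\mathbb{R}^3$ that belong, as tempered distributions, to the Sobolev space $H^{-1}(\mathbb{R}^3)$ (that is, $\int_{\mathbb{R}^3} |\widehat{\mu}(k)|^2/(1+|k|^2)\,dk<\infty$) and that satisfy $\int_{\mathbb{R}^3}|x|^{s-1}\,d\mu(x)<\infty$. Define $$\beta_s := \inf_{\mu\in D_s}\ \frac{\iint_{\mathbb{R}^3\times\mathbb{R}^3}\frac{|x|^s+|y|^s}{2|x-y|}\,d\mu(x)\,d\mu(y)}{\int_{\mathbb{R}^3}|x|^{s-1}\,d\mu(x)},\qquad b(s):=\max_{0\le t\le 1}\frac{1+t^{s-1}}{1+t^s}.$$ Then for every $s\in(1,3]$ the function $t\mapsto t^s+st+1-s$ has exactly one root $t_0$ in $(0,1)$, and $$\beta_s\ \ge\ \min_{t\in[0,1]}\frac{1+t^s}{1+t^{s-1}}\ =\ \frac{s}{s-1}\,t_0\ =\ b(s)^{-1}.$$ In particular, $$\beta_2\ \ge\ b(2)^{-1}=2(\sqrt2-1),\qquad \beta_3\ \ge\ b(3)^{-1}=\frac32\cdot\frac{(1+\sqrt2)^{2/3}-1}{(1+\sqrt2)^{1/3}}.$$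 -/

import Mathlib

open MeasureTheory
open scoped ENNReal

noncomputable section

namespace CoulombMeanField

/-- Euclidean three-space. -/
abbrev E3 : Type := EuclideanSpace ℝ (Fin 3)

/-- The weighted Coulomb interaction
`I_s(μ) = ∬ (|x|^s + |y|^s) / (2 |x - y|) dμ(x) dμ(y)`, with values in `[0, ∞]`. -/
def interaction (s : ℝ) (μ : Measure E3) : ℝ≥0∞ :=
  ∫⁻ x, ∫⁻ y, (‖x‖ₑ ^ s + ‖y‖ₑ ^ s) / (2 * ‖x - y‖ₑ) ∂μ ∂μ

/-- The absolute moment `∫ |x|^t dμ(x)`, with values in `[0, ∞]`. -/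
def moment (t : ℝ) (μ : Measure E3) : ℝ≥0∞ :=
  ∫⁻ x, ‖x‖ₑ ^ t ∂μ

/-- The Borel probability measures on three-space which, as tempered distributions, belong to the
Sobolev space `H^{-1}`, and which have a finite moment of order `s - 1`. -/
def admissible (s : ℝ) : Set (ProbabilityMeasure E3) :=
  {μ | TemperedDistribution.MemSobolev (-1) 2 (μ : Measure E3).toTemperedDistribution ∧
    moment (s - 1) μ < ∞}

/-- The mean-field constant `β_s`: the infimum of `I_s(μ) / ∫ |x|^(s-1) dμ(x)` over all admissible
probability measures (for `s > 1` the denominator is positive and finite, as the Dirac mass at the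
origin is not in `H^{-1}`). -/
def beta (s : ℝ) : ℝ≥0∞ :=
  ⨅ μ ∈ admissible s, interaction s μ / moment (s - 1) μ

/-- `b(s)`, the maximum over `0 ≤ t ≤ 1` of `(1 + t^(s-1)) / (1 + t^s)`. -/
def b (s : ℝ) : ℝ :=
  sSup ((fun t : ℝ => (1 + t ^ (s - 1)) / (1 + t ^ s)) '' Set.Icc 0 1)

end CoulombMeanField

end

/-! ### The one-variable minimisation. -/

namespace CoulombMeanField

/-! Compare $1/|x-y|$ with its spherical average $1/\max(|x|,|y|)$. For the averaged kernel,
homogeneity reduces the bound to a pointwise one-variable inequality, which is Young's inequality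
(`root_value_mul_le`, `root_value_mul_le_weight`).

It remains to see that the nonradial part $(|x|^s+|y|^s)(1/|x-y|-1/\max(|x|,|y|))$ is positive
semidefinite. Its Legendre expansion contains only multipoles $l\ge1$. After factors $w(x)w(y)$ are
pulled out, each is a sum of two kernels $\min(|x|^p,|y|^p)\,P_l(\cos\theta)$ with $p=2l+1\mp s$
(`multipole_factor`). $P_l$ is positive semidefinite on the sphere (`legendre_posSemidef`), and the
factor $\min$ preserves this when the powers increase (`sum_mul_min_nonneg`); $p\ge0$ for all
$l\ge1$ exactly because $s\le3$.

To avoid the singularity, the $l$-th multipole is damped by $\rho^l$, $\rho<1$. The damped kernel is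
dominated by the moment weights, so positivity on finite configurations passes to $\mu\otimes\mu$ by
averaging over independent samples (`integral_prod_nonneg_of_sum_nonneg`). Moreover $\sqrt\rho$
times the damped kernel is at most the Coulomb one; then $\rho\to1$. The $H^{-1}$ condition serves
only to exclude the Dirac mass at the origin. -/

lemma exists_root {s : ℝ} (hs : 1 < s) :
    ∃ t₀ ∈ Set.Ioo (0 : ℝ) 1, t₀ ^ s + s * t₀ + 1 - s = 0 := by
  have hc : ContinuousOn (fun t : ℝ => t ^ s + s * t + 1 - s) (Set.Icc 0 1) := by
    have : Continuous (fun t : ℝ => t ^ s) := Real.continuous_rpow_const (by linarith)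
    fun_prop
  have h := intermediate_value_Ioo (zero_le_one' ℝ) hc
  have h0 : (0 : ℝ) ∈ Set.Ioo ((0 : ℝ) ^ s + s * 0 + 1 - s) ((1 : ℝ) ^ s + s * 1 + 1 - s) := by
    rw [Real.zero_rpow (by linarith), Real.one_rpow]
    constructor <;> linarith
  obtain ⟨t, ht, h⟩ := h h0
  exact ⟨t, ht, h⟩

lemma root_unique {s t u : ℝ} (hs : 1 < s) (ht : 0 < t) (hu : 0 < u)
    (h : t ^ s + s * t + 1 - s = 0) (h' : u ^ s + s * u + 1 - s = 0) : t = u := by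
  rcases lt_trichotomy t u with hlt | rfl | hlt
  · have := Real.rpow_lt_rpow ht.le hlt (by linarith : 0 < s)
    nlinarith
  · rfl
  · have := Real.rpow_lt_rpow hu.le hlt (by linarith : 0 < s)
    nlinarith

/-- Young gives $s\,t^{s-1}t_0\le(s-1)t^s+t_0^s$, and the root equation replaces $t_0^s$ by
$s-1-st_0$. -/
lemma root_value_mul_le {s t₀ t : ℝ} (hs : 1 < s) (ht₀ : 0 < t₀)
    (h : t₀ ^ s + s * t₀ + 1 - s = 0) (ht : 0 ≤ t) :
    s / (s - 1) * t₀ * (1 + t ^ (s - 1)) ≤ 1 + t ^ s := by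
  have hs0 : 0 < s := by linarith
  have hs1 : 0 < s - 1 := by linarith
  have key := Real.geom_mean_le_arith_mean2_weighted (w₁ := (s - 1) / s) (w₂ := 1 / s)
    (p₁ := t ^ s) (p₂ := t₀ ^ s) (by positivity) (by positivity) (by positivity) (by positivity)
    (by field_simp; ring)
  rw [← Real.rpow_mul ht, ← Real.rpow_mul ht₀.le, mul_div_cancel₀ _ hs0.ne',
    mul_div_cancel₀ _ hs0.ne', Real.rpow_one] at key
  have h2 : s * (t ^ (s - 1) * t₀) ≤ (s - 1) * t ^ s + t₀ ^ s := by
    calc s * (t ^ (s - 1) * t₀) ≤ s * ((s - 1) / s * t ^ s + 1 / s * t₀ ^ s) := by gcongr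
      _ = _ := by field_simp
  rw [div_mul_eq_mul_div, div_mul_eq_mul_div, div_le_iff₀ hs1]
  nlinarith

lemma ratio_at_root {s t₀ : ℝ} (hs : 1 < s) (ht₀ : 0 < t₀)
    (h : t₀ ^ s + s * t₀ + 1 - s = 0) :
    (1 + t₀ ^ s) / (1 + t₀ ^ (s - 1)) = s / (s - 1) * t₀ := by
  have hs1 : 0 < s - 1 := by linarith
  have : t₀ ^ s = t₀ ^ (s - 1) * t₀ := by
    rw [← Real.rpow_add_one ht₀.ne', sub_add_cancel]
  have hp : 0 < t₀ ^ (s - 1) := by positivity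
  rw [div_eq_iff (by positivity), div_mul_eq_mul_div, div_mul_eq_mul_div, eq_div_iff hs1.ne']
  linear_combination s * this - h

lemma isLeast_ratio {s t₀ : ℝ} (hs : 1 < s) (ht₀ : t₀ ∈ Set.Ioo (0 : ℝ) 1)
    (h : t₀ ^ s + s * t₀ + 1 - s = 0) :
    IsLeast ((fun t : ℝ => (1 + t ^ s) / (1 + t ^ (s - 1))) '' Set.Icc 0 1)
      (s / (s - 1) * t₀) := by
  refine ⟨⟨t₀, Set.Ioo_subset_Icc_self ht₀, ratio_at_root hs ht₀.1 h⟩, ?_⟩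
  rintro _ ⟨t, ht, rfl⟩
  have hp : 0 ≤ t ^ (s - 1) := Real.rpow_nonneg ht.1 _
  change _ ≤ (1 + t ^ s) / (1 + t ^ (s - 1))
  rw [le_div_iff₀ (by positivity)]
  exact root_value_mul_le hs ht₀.1 h ht.1

lemma isGreatest_inverse_ratio {s t₀ : ℝ} (hs : 1 < s) (ht₀ : t₀ ∈ Set.Ioo (0 : ℝ) 1)
    (h : t₀ ^ s + s * t₀ + 1 - s = 0) :
    IsGreatest ((fun t : ℝ => (1 + t ^ (s - 1)) / (1 + t ^ s)) '' Set.Icc 0 1)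
      (s / (s - 1) * t₀)⁻¹ := by
  have hs1 : 0 < s - 1 := by linarith
  have hm : 0 < s / (s - 1) * t₀ := mul_pos (div_pos (by linarith) hs1) ht₀.1
  refine ⟨⟨t₀, Set.Ioo_subset_Icc_self ht₀, ?_⟩, ?_⟩
  · rw [← ratio_at_root hs ht₀.1 h, inv_div]
  rintro _ ⟨t, ht, rfl⟩
  have hp : 0 ≤ t ^ s := Real.rpow_nonneg ht.1 _
  change (1 + t ^ (s - 1)) / (1 + t ^ s) ≤ _
  rw [div_le_iff₀ (by positivity), inv_mul_eq_div, le_div_iff₀ hm, mul_comm]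
  exact root_value_mul_le hs ht₀.1 h ht.1

lemma root_two : (√2 - 1) ^ (2 : ℝ) + 2 * (√2 - 1) + 1 - 2 = 0 := by
  have h : √2 ^ 2 = 2 := Real.sq_sqrt (by norm_num)
  rw [Real.rpow_two]
  linear_combination h

lemma sqrt_two_sub_one_mem : √2 - 1 ∈ Set.Ioo (0 : ℝ) 1 := by
  have h : √2 ^ 2 = 2 := Real.sq_sqrt (by norm_num)
  have h0 : 0 ≤ √2 := Real.sqrt_nonneg _
  constructor <;> nlinarith

/-- Cardano: $t=a-1/a$ with $a^3=1+\sqrt2$, so $t^3+3t=a^3-a^{-3}=2$. -/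
lemma root_three_pos_and_eq {t : ℝ}
    (ht : t = ((1 + √2) ^ (2 / 3 : ℝ) - 1) / (1 + √2) ^ (1 / 3 : ℝ)) :
    t ∈ Set.Ioo (0 : ℝ) 1 ∧ t ^ (3 : ℝ) + 3 * t + 1 - 3 = 0 := by
  have h : √2 ^ 2 = 2 := Real.sq_sqrt (by norm_num)
  have h0 : 0 ≤ √2 := Real.sqrt_nonneg _
  set a : ℝ := (1 + √2) ^ (1 / 3 : ℝ) with ha
  have ha0 : 0 < a := by positivity
  have ha2 : (1 + √2) ^ (2 / 3 : ℝ) = a ^ 2 := by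
    rw [ha, ← Real.rpow_natCast, ← Real.rpow_mul (by positivity)]; norm_num
  have ha3 : a ^ 3 = 1 + √2 := by
    rw [ha, ← Real.rpow_natCast, ← Real.rpow_mul (by positivity)]; norm_num
  rw [ha2] at ht
  have hta : t * a = a ^ 2 - 1 := by rw [ht]; field_simp
  have h3 : t ^ 3 + 3 * t + 1 - 3 = 0 := by
    have : a ^ 3 * (t ^ 3 + 3 * t + 1 - 3) = 0 := by
      have e : a ^ 3 * (t ^ 3 + 3 * t + 1 - 3) = (t * a) ^ 3 + 3 * a ^ 2 * (t * a) - 2 * a ^ 3 := by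
        ring
      rw [e, hta]
      have : (a ^ 2 - 1) ^ 3 + 3 * a ^ 2 * (a ^ 2 - 1) - 2 * a ^ 3 = (a ^ 3) ^ 2 - 2 * a ^ 3 - 1 := by
        ring
      rw [this, ha3]
      linear_combination h
    exact (mul_eq_zero.mp this).resolve_left (by positivity)
  have h3' : t ^ (3 : ℝ) = t ^ 3 := by exact_mod_cast Real.rpow_natCast t 3
  refine ⟨⟨?_, ?_⟩, by rw [h3']; exact h3⟩
  · by_contra! hneg
    have : t ^ 3 ≤ 0 := by nlinarith [sq_nonneg t]
    linarith
  · by_contra! hge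
    have : 1 ≤ t ^ 3 := one_le_pow₀ hge
    linarith

end CoulombMeanField

/-! ### The Dirac mass at the origin is not in $H^{-1}$. -/

namespace CoulombMeanField

open scoped SchwartzMap FourierTransform

/-- The Fourier transform of the Dirac mass is the constant 1, so the Bessel weight itself is
represented by an $L^2$ function. -/
lemma exists_memLp_pairing {μ : Measure E3} [IsProbabilityMeasure μ] [μ.HasTemperateGrowth]
    (h : TemperedDistribution.MemSobolev (-1) 2 μ.toTemperedDistribution)
    (h0 : ∀ᵐ x ∂μ, x = 0) :
    ∃ g : E3 → ℂ, MemLp g 2 ∧ ∀ φ : 𝓢(E3, ℂ),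
      ∫ k, (((1 + ‖k‖ ^ 2) ^ (-1 / 2 : ℝ) : ℝ) : ℂ) * φ k = ∫ k, φ k * g k := by
  obtain ⟨g, hg⟩ := TemperedDistribution.memSobolev_iff_exists_smulLeftCLM_fourier.mp h
  refine ⟨g, Lp.memLp g, fun φ => ?_⟩
  have hm : Function.HasTemperateGrowth
      (fun k : E3 => (((1 + ‖k‖ ^ 2) ^ (-1 / 2 : ℝ) : ℝ) : ℂ)) := by fun_prop
  have := DFunLike.congr_fun hg φ
  rw [TemperedDistribution.smulLeftCLM_apply_apply, TemperedDistribution.fourier_apply,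
    Lp.toTemperedDistribution_apply] at this
  replace this := (Measure.toTemperedDistribution_apply (μ := μ) _).symm.trans this
  simp only [smul_eq_mul] at this
  rw [← this]
  set ψ := SchwartzMap.smulLeftCLM ℂ (fun k : E3 => (((1 + ‖k‖ ^ 2) ^ (-1 / 2 : ℝ) : ℝ) : ℂ)) φ
    with hψ
  have h1 : ∫ x, (𝓕 ψ) x ∂μ = (𝓕 ψ) 0 := by
    rw [integral_congr_ae (g := fun _ => (𝓕 ψ) 0)]
    · simp
    · filter_upwards [h0] with x hx
      rw [hx]
  rw [h1, SchwartzMap.fourier_coe, Real.fourier_eq]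
  simp [hψ, SchwartzMap.smulLeftCLM_apply_apply hm]

/-- $(1+|k|^2)^{-1/2}$ is not square integrable in dimension three: testing against a bump at scale
$R$ would give $VR\le9N$ for every $R\ge1$. -/
lemma not_ae_eq_zero_of_memSobolev {μ : Measure E3} [IsProbabilityMeasure μ]
    [μ.HasTemperateGrowth]
    (h : TemperedDistribution.MemSobolev (-1) 2 μ.toTemperedDistribution) :
    ¬ ∀ᵐ x ∂μ, x = 0 := by
  intro h0
  obtain ⟨g, hg, hpair⟩ := exists_memLp_pairing h h0
  set N : ℝ := ∫ k, ‖g k‖ ^ 2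
  have hN : Integrable (fun k => ‖g k‖ ^ 2) := hg.norm.integrable_sq
  set V : ℝ := volume.real (Metric.closedBall (0 : E3) 1) with hVdef
  have hV : 0 < V := ENNReal.toReal_pos
    (Metric.measure_closedBall_pos volume _ one_pos).ne' measure_closedBall_lt_top.ne
  have key : ∀ R : ℝ, 1 ≤ R → V * R ≤ 9 * N := by
    intro R hR
    have hR0 : 0 < R := by linarith
    let f : ContDiffBump (0 : E3) := ⟨R, 2 * R, hR0, by linarith⟩
    have hfi : Integrable f := f.integrable
    have hcs : HasCompactSupport (fun k => (f k : ℂ)) :=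
      f.hasCompactSupport.comp_left Complex.ofReal_zero
    have hcd : ContDiff ℝ (⊤ : ℕ∞) (fun k => (f k : ℂ)) :=
      Complex.ofRealCLM.contDiff.comp f.contDiff
    have hp := hpair (hcs.toSchwartzMap hcd)
    have hval : ∀ k, (hcs.toSchwartzMap hcd) k = (f k : ℂ) := fun k => rfl
    simp only [hval] at hp
    -- On the support $|k|<2R$ and $R\ge1$, so $1+|k|^2\le(3R)^2$.
    have hleft : (3 * R)⁻¹ * ∫ k, f k ≤ ‖∫ k, (((1 + ‖k‖ ^ 2) ^ (-1 / 2 : ℝ) : ℝ) : ℂ) * f k‖ := by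
      have : ∫ k, (((1 + ‖k‖ ^ 2) ^ (-1 / 2 : ℝ) : ℝ) : ℂ) * f k =
          ((∫ k, (1 + ‖k‖ ^ 2) ^ (-1 / 2 : ℝ) * f k : ℝ) : ℂ) := by
        rw [← integral_complex_ofReal]; simp
      rw [this, Complex.norm_real, ← integral_const_mul]
      refine le_trans ?_ (le_abs_self _)
      have hcont : Continuous (fun k : E3 => (1 + ‖k‖ ^ 2) ^ (-1 / 2 : ℝ)) := by
        refine Continuous.rpow_const (by fun_prop) fun k => Or.inl (by positivity)
      refine integral_mono (hfi.const_mul _) ?_ fun k => ?_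
      · exact (hcont.mul f.continuous).integrable_of_hasCompactSupport
          f.hasCompactSupport.mul_left
      · by_cases hk : 2 * R ≤ dist k 0
        · simp [f.zero_of_le_dist hk]
        · refine mul_le_mul_of_nonneg_right ?_ f.nonneg
          rw [dist_zero_right, not_le] at hk
          have h3 : ((3 * R) ^ 2) ^ (-1 / 2 : ℝ) = (3 * R)⁻¹ := by
            rw [← Real.rpow_natCast, ← Real.rpow_mul (by positivity)]
            norm_num
            rw [Real.rpow_neg_one, mul_inv]
            ring
          rw [← h3]
          refine Real.rpow_le_rpow_of_nonpos (by positivity) ?_ (by norm_num)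
          nlinarith [norm_nonneg k]
    -- AM-GM, weighted so that half of the lower bound in `hleft` reappears and can be absorbed;
    -- $f^2\le f$ is used.
    have hright : ‖∫ k, (f k : ℂ) * g k‖ ≤ ((3 * R)⁻¹ * ∫ k, f k) / 2 + (3 * R) * N / 2 := by
      have hi : Integrable (fun k => (3 * R)⁻¹ * f k / 2 + (3 * R) * ‖g k‖ ^ 2 / 2) :=
        ((hfi.const_mul _).div_const 2).add ((hN.const_mul _).div_const 2)
      calc ‖∫ k, (f k : ℂ) * g k‖
          ≤ ∫ k, ((3 * R)⁻¹ * f k / 2 + (3 * R) * ‖g k‖ ^ 2 / 2) := by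
            refine norm_integral_le_of_norm_le hi (Filter.Eventually.of_forall fun k => ?_)
            have hf0 : 0 ≤ f k := f.nonneg
            have hf1 : f k ≤ 1 := f.le_one
            rw [norm_mul, Complex.norm_real, Real.norm_of_nonneg hf0]
            have e : (3 * R)⁻¹ * f k / 2 + (3 * R) * ‖g k‖ ^ 2 / 2 =
                (f k + (3 * R * ‖g k‖) ^ 2) / (2 * (3 * R)) := by field_simp
            rw [e, le_div_iff₀ (by positivity)]
            nlinarith [sq_nonneg (f k - 3 * R * ‖g k‖)]
        _ = _ := by
            rw [integral_add ((hfi.const_mul _).div_const 2) ((hN.const_mul _).div_const 2),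
              integral_div, integral_div, integral_const_mul, integral_const_mul]
    have hvol : V * R ^ 3 ≤ ∫ k, f k := by
      refine le_trans (le_of_eq ?_) (f.measure_closedBall_le_integral volume)
      change _ = volume.real (Metric.closedBall (0 : E3) R)
      rw [Measure.addHaar_real_closedBall' volume 0 hR0.le]
      simp [hVdef, mul_comm]
    rw [← hp] at hright
    have h4 := hleft.trans hright
    have h5 : (3 * R)⁻¹ * (V * R ^ 3) ≤ (3 * R)⁻¹ * ∫ k, f k := by gcongr
    have h6 : (3 * R)⁻¹ * (V * R ^ 3) = V * R * R / 3 := by field_simp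
    have h7 : V * R * R ≤ 9 * N * R := by linarith
    exact le_of_mul_le_mul_right h7 hR0
  have h1 := key 1 le_rfl
  have h2 := key (9 * N / V + 1) (by
    have : 0 ≤ N := integral_nonneg fun k => by positivity
    have : 0 ≤ 9 * N / V := by positivity
    linarith)
  rw [mul_add, mul_div_cancel₀ _ hV.ne'] at h2
  linarith

lemma moment_ne_zero {s : ℝ} (hs : 1 < s) {μ : ProbabilityMeasure E3} (hμ : μ ∈ admissible s) :
    moment (s - 1) μ ≠ 0 := by
  intro h
  have hm : Measurable (fun x : E3 => ‖x‖ₑ ^ (s - 1)) := by fun_prop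
  rw [moment, lintegral_eq_zero_iff hm] at h
  refine not_ae_eq_zero_of_memSobolev hμ.1 ?_
  filter_upwards [h] with x hx
  have : 0 < s - 1 := by linarith
  simpa [ENNReal.rpow_eq_zero_iff, this, this.not_gt] using hx

end CoulombMeanField

/-! ### Legendre polynomials: three-term recurrence. -/

namespace CoulombMeanField

open Finset Polynomial

/-- The polynomial `∑ j, (n choose j) ^ 2 X ^ j`. -/
noncomputable def squareChoosePoly (n : ℕ) : ℝ[X] := ∑ j ∈ range (n + 1), C ((n.choose j : ℝ) ^ 2) * X ^ j

lemma coeff_squareChoosePoly (n j : ℕ) : (squareChoosePoly n).coeff j = (n.choose j : ℝ) ^ 2 := by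
  simp only [squareChoosePoly, finsetSum_coeff, coeff_C_mul, coeff_X_pow, mul_ite, mul_one,
    mul_zero, sum_ite_eq, mem_range]
  split_ifs with h
  · rfl
  · rw [Nat.choose_eq_zero_of_lt (by omega)]; simp

/-- Coefficientwise, everything is quadratic in three consecutive binomials, which are tied by
$(m+1)\binom n{m+1}=(n-m)\binom nm$. -/
lemma squareChoosePoly_recurrence (n : ℕ) :
    C ((n : ℝ) + 2) * squareChoosePoly (n + 2) =
      C (2 * (n : ℝ) + 3) * (squareChoosePoly (n + 1) * X + squareChoosePoly (n + 1)) -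
        C ((n : ℝ) + 1) * (squareChoosePoly n * X * X - C 2 * (squareChoosePoly n * X) +
          squareChoosePoly n) := by
  ext j
  match j with
  | 0 =>
    simp [coeff_squareChoosePoly]
    ring
  | 1 =>
    have h (p : ℝ[X]) : (p * X).coeff 1 = p.coeff 0 := coeff_mul_X p 0
    simp only [coeff_C_mul, coeff_sub, coeff_add, h, coeff_squareChoosePoly, coeff_mul_X_zero]
    simp
    ring
  | k + 2 =>
    simp only [coeff_C_mul, coeff_sub, coeff_add, coeff_mul_X, coeff_squareChoosePoly]
    have e1 : ((n + 1).choose (k + 1) : ℝ) = n.choose k + n.choose (k + 1) := by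
      rw [Nat.choose_succ_succ]; push_cast; ring
    have e2 : ((n + 1).choose (k + 2) : ℝ) = n.choose (k + 1) + n.choose (k + 2) := by
      rw [Nat.choose_succ_succ]; push_cast; ring
    have e3 : ((n + 2).choose (k + 2) : ℝ) =
        n.choose k + 2 * n.choose (k + 1) + n.choose (k + 2) := by
      rw [Nat.choose_succ_succ, Nat.cast_add, e1, e2]; ring
    have r : ∀ m : ℕ, ((m : ℝ) + 1) * n.choose (m + 1) = (n - m) * n.choose m := by
      intro m
      have h := Nat.choose_succ_right_eq n m
      rcases le_or_gt m n with hm | hm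
      · have h' : (n.choose (m + 1) : ℝ) * (m + 1) = n.choose m * ((n - m : ℕ) : ℝ) := by
          exact_mod_cast h
        rw [Nat.cast_sub hm] at h'
        linarith
      · rw [Nat.choose_eq_zero_of_lt hm, Nat.choose_eq_zero_of_lt (by omega)]; simp
    have r1 := r k
    have r2 := r (k + 1)
    push_cast at r2
    rw [e1, e2, e3]
    set x : ℝ := ((n.choose k : ℕ) : ℝ)
    set y : ℝ := ((n.choose (k + 1) : ℕ) : ℝ)
    set z : ℝ := ((n.choose (k + 1 + 1) : ℕ) : ℝ)
    change ((n : ℝ) + 2) * (x + 2 * y + z) ^ 2 = (2 * n + 3) * ((x + y) ^ 2 + (y + z) ^ 2) -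
      (n + 1) * (x ^ 2 - 2 * y ^ 2 + z ^ 2)
    linear_combination (-2 * y - 2 * z) * r1 + (2 * x + 2 * y) * r2

/-- The Legendre polynomial `P_n` as a function on the line. -/
noncomputable def legendre (n : ℕ) (c : ℝ) : ℝ :=
  ∑ j ∈ range (n + 1), (n.choose j : ℝ) ^ 2 * ((1 + c) / 2) ^ j * ((c - 1) / 2) ^ (n - j)

lemma legendre_one_right (n : ℕ) : legendre n 1 = 1 := by
  rw [legendre, sum_eq_single n]
  · simp
  · intro j hj hjn
    have : n - j ≠ 0 := by have := mem_range.mp hj; omega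
    simp [this]
  · simp

lemma legendre_zero (c : ℝ) : legendre 0 c = 1 := by simp [legendre]

lemma legendre_one (c : ℝ) : legendre 1 c = c := by
  simp [legendre, sum_range_succ]; ring

lemma legendre_eq_eval {c : ℝ} (hc : c ≠ 1) (n : ℕ) :
    legendre n c = ((c - 1) / 2) ^ n * (squareChoosePoly n).eval ((1 + c) / (c - 1)) := by
  have hc' : c - 1 ≠ 0 := sub_ne_zero.mpr hc
  rw [legendre, squareChoosePoly, eval_finsetSum, mul_sum]
  refine sum_congr rfl fun j hj => ?_
  have hjn : j ≤ n := by have := mem_range.mp hj; omega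
  have e : (1 + c) / 2 = (c - 1) / 2 * ((1 + c) / (c - 1)) := by field_simp
  have e2 : ((c - 1) / 2) ^ n = ((c - 1) / 2) ^ j * ((c - 1) / 2) ^ (n - j) := by
    rw [← pow_add, Nat.add_sub_cancel' hjn]
  simp only [eval_mul, eval_C, eval_pow, eval_X]
  rw [e2, e, mul_pow]
  ring

lemma legendre_recurrence (n : ℕ) (c : ℝ) :
    ((n : ℝ) + 2) * legendre (n + 2) c =
      (2 * n + 3) * c * legendre (n + 1) c - (n + 1) * legendre n c := by
  -- The substitution $d=(1+c)/(c-1)$ has its pole here.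
  by_cases hc : c = 1
  · subst hc; simp only [legendre_one_right]; ring
  have hc' : c - 1 ≠ 0 := sub_ne_zero.mpr hc
  have h := congrArg (eval ((1 + c) / (c - 1))) (squareChoosePoly_recurrence n)
  simp only [eval_mul, eval_C, eval_add, eval_sub, eval_X] at h
  rw [legendre_eq_eval hc, legendre_eq_eval hc, legendre_eq_eval hc]
  set f0 := eval ((1 + c) / (c - 1)) (squareChoosePoly n)
  set f1 := eval ((1 + c) / (c - 1)) (squareChoosePoly (n + 1))
  set f2 := eval ((1 + c) / (c - 1)) (squareChoosePoly (n + 2))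
  obtain ⟨d, hd⟩ : ∃ d, d = (1 + c) / (c - 1) := ⟨_, rfl⟩
  rw [← hd] at h
  have h1 : d * (c - 1) = 1 + c := by rw [hd]; field_simp
  have h2 : (d + 1) * ((c - 1) / 2) = c := by linarith
  have h3 : (d - 1) * ((c - 1) / 2) = 1 := by linarith
  have h4 : (d - 1) ^ 2 * ((c - 1) / 2) ^ 2 = 1 := by rw [← mul_pow, h3, one_pow]
  rw [pow_add, pow_succ]
  linear_combination ((c - 1) / 2) ^ n * ((c - 1) / 2) ^ 2 * h +
    ((c - 1) / 2) ^ n * ((c - 1) / 2) * (2 * n + 3) * f1 * h2 -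
    ((c - 1) / 2) ^ n * (n + 1) * f0 * h4

/-! ### The Legendre generating function. -/

section GeneratingFunction

open PowerSeries in
-- The recurrence says $DF'=(c-X)F$, hence $(DF^2)'=0$, and the constant term is 1.
lemma legendre_series_sq (c : ℝ) :
    ((1 : PowerSeries ℝ) - PowerSeries.C (2 * c) * PowerSeries.X + PowerSeries.X * PowerSeries.X) *
      (PowerSeries.mk (fun n => legendre n c) * PowerSeries.mk (fun n => legendre n c)) = 1 := by
  set F : PowerSeries ℝ := PowerSeries.mk (fun n => legendre n c) with hF
  set D : PowerSeries ℝ := 1 - PowerSeries.C (2 * c) * PowerSeries.X +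
    PowerSeries.X * PowerSeries.X with hD
  have hode : D * PowerSeries.derivative ℝ F = (PowerSeries.C c - PowerSeries.X) * F := by
    have hode' : PowerSeries.derivative ℝ F -
        PowerSeries.C (2 * c) * (PowerSeries.derivative ℝ F * PowerSeries.X) +
        PowerSeries.derivative ℝ F * PowerSeries.X * PowerSeries.X =
        PowerSeries.C c * F - F * PowerSeries.X := by
      have h0 (G : PowerSeries ℝ) : (G * PowerSeries.X).coeff 1 = G.coeff 0 :=
        PowerSeries.coeff_succ_mul_X 0 G
      ext n
      match n with
      | 0 =>
        simp only [map_sub, map_add, PowerSeries.coeff_C_mul, PowerSeries.coeff_zero_mul_X,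
          PowerSeries.coeff_derivative, hF, PowerSeries.coeff_mk, legendre_zero]
        norm_num [legendre_one]
      | 1 =>
        have := legendre_recurrence 0 c
        simp only [map_sub, map_add, PowerSeries.coeff_C_mul, h0, PowerSeries.coeff_zero_mul_X,
          PowerSeries.coeff_derivative, hF, PowerSeries.coeff_mk, legendre_one, legendre_zero]
          at this ⊢
        norm_num [legendre_one] at this ⊢
        linarith
      | n + 2 =>
        have := legendre_recurrence (n + 1) c
        simp only [map_sub, map_add, PowerSeries.coeff_C_mul, show n + 2 = n + 1 + 1 from rfl,
          PowerSeries.coeff_succ_mul_X, PowerSeries.coeff_derivative, hF, PowerSeries.coeff_mk]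
          at this ⊢
        push_cast at this ⊢
        linarith
    rw [hD]
    linear_combination hode'
  apply PowerSeries.derivative.ext
  · have hdD : PowerSeries.derivative ℝ D = 2 * PowerSeries.X - PowerSeries.C (2 * c) := by
      simp [hD, PowerSeries.derivative_C]
      ring
    have h2 : PowerSeries.C (2 * c) = 2 * PowerSeries.C c := by
      rw [map_mul]; rfl
    simp only [Derivation.leibniz, smul_eq_mul, hdD, Derivation.map_one_eq_zero]
    rw [h2]
    linear_combination 2 * F * hode
  · simp [hD, hF, legendre_zero]

lemma tsum_powerSeries_mul {A B : PowerSeries ℝ} {r : ℝ}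
    (hA : Summable fun n => ‖A.coeff n * r ^ n‖) (hB : Summable fun n => ‖B.coeff n * r ^ n‖) :
    Summable (fun n => ‖(A * B).coeff n * r ^ n‖) ∧
      ∑' n, (A * B).coeff n * r ^ n = (∑' n, A.coeff n * r ^ n) * ∑' n, B.coeff n * r ^ n := by
  have e : ∀ n, (A * B).coeff n * r ^ n =
      ∑ kl ∈ antidiagonal n, (A.coeff kl.1 * r ^ kl.1) * (B.coeff kl.2 * r ^ kl.2) := by
    intro n
    rw [PowerSeries.coeff_mul, sum_mul]
    refine sum_congr rfl fun kl hkl => ?_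
    rw [← mem_antidiagonal.mp hkl, pow_add]
    ring
  simp only [e]
  have h1 := summable_norm_sum_mul_antidiagonal_of_summable_norm
    (f := fun n => A.coeff n * r ^ n) (g := fun n => B.coeff n * r ^ n) hA hB
  have h2 := tsum_mul_tsum_eq_tsum_sum_antidiagonal_of_summable_norm
    (f := fun n => A.coeff n * r ^ n) (g := fun n => B.coeff n * r ^ n) hA hB
  exact ⟨h1, h2.symm⟩

lemma summable_legendre {c r : ℝ} (hc : ∀ n, |legendre n c| ≤ 1) (hr0 : 0 ≤ r) (hr : r < 1) :
    Summable fun n => ‖legendre n c * r ^ n‖ := by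
  refine Summable.of_nonneg_of_le (fun _ => norm_nonneg _) (fun n => ?_)
    (summable_geometric_of_lt_one hr0 hr)
  rw [norm_mul, Real.norm_eq_abs, norm_pow, Real.norm_of_nonneg hr0]
  exact mul_le_of_le_one_left (by positivity) (hc n)

lemma legendre_tsum_sq {c r : ℝ} (hc : ∀ n, |legendre n c| ≤ 1) (hr0 : 0 ≤ r) (hr : r < 1) :
    (1 - 2 * c * r + r ^ 2) * (∑' n, legendre n c * r ^ n) ^ 2 = 1 := by
  set F : PowerSeries ℝ := PowerSeries.mk (fun n => legendre n c) with hF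
  set D : PowerSeries ℝ := 1 - PowerSeries.C (2 * c) * PowerSeries.X +
    PowerSeries.X * PowerSeries.X with hD
  have hFs : Summable fun n => ‖F.coeff n * r ^ n‖ := by
    simpa [hF] using summable_legendre hc hr0 hr
  have hD0 : ∀ n ∉ range 3, D.coeff n * r ^ n = 0 := by
    intro n hn
    obtain ⟨m, rfl⟩ : ∃ m, n = m + 3 := ⟨n - 3, by rw [mem_range] at hn; omega⟩
    simp [hD, PowerSeries.coeff_one, ← pow_two, PowerSeries.coeff_X_pow]
  have hDs : Summable fun n => ‖D.coeff n * r ^ n‖ :=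
    summable_of_ne_finset_zero (s := range 3) fun n hn => by rw [hD0 n hn, norm_zero]
  have hDt : ∑' n, D.coeff n * r ^ n = 1 - 2 * c * r + r ^ 2 := by
    rw [tsum_eq_sum hD0]
    simp [sum_range_succ, hD, PowerSeries.coeff_one, ← pow_two, PowerSeries.coeff_X_pow]
    ring
  have h1 := tsum_powerSeries_mul hFs hFs
  have h2 := (tsum_powerSeries_mul hDs h1.1).2
  rw [legendre_series_sq c, h1.2, hDt] at h2
  rw [tsum_eq_single 0 (by intro n hn; simp [PowerSeries.coeff_one, hn])] at h2
  simpa [hF, pow_two] using h2.symm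

/-- The squared identity leaves only the sign open; the sum is continuous and nonvanishing on
$[0,r]$ and equals 1 at 0. -/
lemma legendre_tsum {c r : ℝ} (hc : ∀ n, |legendre n c| ≤ 1) (hr0 : 0 ≤ r) (hr : r < 1) :
    ∑' n, legendre n c * r ^ n = (√(1 - 2 * c * r + r ^ 2))⁻¹ := by
  set f : ℝ → ℝ := fun r => ∑' n, legendre n c * r ^ n with hf
  have hcont : ContinuousOn f (Set.Icc 0 r) := by
    refine continuousOn_tsum (u := fun n => r ^ n) (fun n => by fun_prop)
      (summable_geometric_of_lt_one hr0 hr) fun n x hx => ?_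
    rw [norm_mul, Real.norm_eq_abs, norm_pow, Real.norm_of_nonneg hx.1]
    calc |legendre n c| * x ^ n ≤ 1 * r ^ n := by
          have := hx.1
          have := hx.2
          gcongr
          exact hc n
      _ = r ^ n := one_mul _
  have hne : ∀ x ∈ Set.Icc 0 r, f x ≠ 0 := by
    intro x hx h0
    have := legendre_tsum_sq hc hx.1 (hx.2.trans_lt hr)
    change (1 - 2 * c * x + x ^ 2) * f x ^ 2 = 1 at this
    rw [h0] at this
    norm_num at this
  have hf0 : f 0 = 1 := by
    simp only [hf]
    rw [tsum_eq_single 0 (by intro n hn; simp [hn])]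
    simp [legendre_zero]
  have hpos : 0 < f r := by
    by_contra! hle
    obtain ⟨x, hx, hx0⟩ := intermediate_value_Icc' hr0 hcont ⟨hle, by rw [hf0]; norm_num⟩
    exact hne x hx hx0
  have hsq := legendre_tsum_sq hc hr0 hr
  change (1 - 2 * c * r + r ^ 2) * f r ^ 2 = 1 at hsq
  change f r = _
  have : 1 - 2 * c * r + r ^ 2 = (f r)⁻¹ ^ 2 := by
    rw [inv_pow]; exact eq_inv_of_mul_eq_one_left hsq
  rw [this, Real.sqrt_sq (by positivity), inv_inv]

end GeneratingFunction

end CoulombMeanField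

/-! ### Positive semidefiniteness of $P_l$ on the sphere, through spinors. -/

namespace CoulombMeanField

open Finset Polynomial

section LinearFormPowers

variable {R : Type*} [CommRing R]

lemma coeff_linear_pow (u v : R) (n m : ℕ) :
    ((C u + X * C v) ^ n).coeff m = n.choose m * (u ^ (n - m) * v ^ m) := by
  rw [add_comm, add_pow, finsetSum_coeff]
  have h : ∀ k, ((X * C v) ^ k * C u ^ (n - k) * (n.choose k : R[X])).coeff m =
      if m = k then (n.choose m : R) * (u ^ (n - m) * v ^ m) else 0 := by
    intro k
    have e : (X * C v) ^ k * C u ^ (n - k) * (n.choose k : R[X]) =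
        C ((n.choose k : R) * (u ^ (n - k) * v ^ k)) * X ^ k := by
      rw [mul_pow, map_mul, map_mul, map_pow, map_pow, map_natCast]
      ring
    rw [e, coeff_C_mul_X_pow]
    split_ifs with hk
    · rw [hk]
    · rfl
  simp only [h, sum_ite_eq, mem_range]
  split_ifs with hm
  · rfl
  · rw [Nat.choose_eq_zero_of_lt (by omega)]; simp

/-- Expand $(a(p+rX)+b(q+tX))^{2l}$ in two ways and read off the coefficient of $X^l$. -/
lemma sum_choose_mul_coeff (a b p q r t : R) (l : ℕ) :
    ∑ k ∈ range (2 * l + 1), ((2 * l).choose k : R) * (a ^ k * b ^ (2 * l - k)) *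
        ((C p + X * C r) ^ k * (C q + X * C t) ^ (2 * l - k)).coeff l =
      (2 * l).choose l * ((a * p + b * q) ^ l * (a * r + b * t) ^ l) := by
  have h := coeff_linear_pow (a * p + b * q) (a * r + b * t) (2 * l) l
  rw [show 2 * l - l = l by omega] at h
  rw [← h]
  have e : C (a * p + b * q) + X * C (a * r + b * t) =
      C a * (C p + X * C r) + C b * (C q + X * C t) := by
    simp only [map_add, map_mul]; ring
  rw [e, add_pow, finsetSum_coeff]
  refine sum_congr rfl fun k _ => ?_
  have e2 : (C a * (C p + X * C r)) ^ k * (C b * (C q + X * C t)) ^ (2 * l - k) *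
      ((2 * l).choose k : R[X]) =
      C (((2 * l).choose k : R) * (a ^ k * b ^ (2 * l - k))) *
        ((C p + X * C r) ^ k * (C q + X * C t) ^ (2 * l - k)) := by
    rw [mul_pow, mul_pow]
    simp only [map_mul, map_pow, map_natCast]
    ring
  rw [e2, coeff_C_mul]

lemma coeff_linear_pow_mul (u v w z : R) (l : ℕ) :
    ((C u + X * C v) ^ l * (C w + X * C z) ^ l).coeff l =
      ∑ j ∈ range (l + 1), (l.choose j : R) ^ 2 * (u * z) ^ j * (v * w) ^ (l - j) := by
  rw [mul_comm, coeff_mul, Nat.sum_antidiagonal_eq_sum_range_succ_mk]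
  refine sum_congr rfl fun j hj => ?_
  have hj' : j ≤ l := by have := mem_range.mp hj; omega
  simp only [coeff_linear_pow]
  rw [Nat.choose_symm hj', Nat.sub_sub_self hj', mul_pow, mul_pow]
  ring

/-- The middle component of the spinor power attached to `(a, b)`, in the `k`-th slot. -/
noncomputable def spinorCoeff (l k : ℕ) (p q r t : R) : R :=
  ((C p + X * C r) ^ k * (C q + X * C t) ^ (2 * l - k)).coeff l

lemma sum_spinorCoeff_mul (p q r t p' q' r' t' : R) (l : ℕ) :
    ∑ k ∈ range (2 * l + 1), ((2 * l).choose k : R) * spinorCoeff l k p q r t *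
        spinorCoeff l k p' q' r' t' =
      (2 * l).choose l * ∑ j ∈ range (l + 1), (l.choose j : R) ^ 2 *
        ((p * p' + q * q') * (r * r' + t * t')) ^ j *
        ((r * p' + t * q') * (p * r' + q * t')) ^ (l - j) := by
  -- The previous identity over `R[X]`, with $a,b$ themselves linear forms: extracting the
  -- coefficient in the second variable pairs two spinor powers.
  have h := congrArg (fun f : R[X] => f.coeff l)
    (sum_choose_mul_coeff (C p + X * C r) (C q + X * C t) (C p') (C q') (C r') (C t') l)
  have hc : ∀ k, ((C (C p') + X * C (C r')) ^ k * (C (C q') + X * C (C t')) ^ (2 * l - k) :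
      R[X][X]).coeff l = C (spinorCoeff l k p' q' r' t') := by
    intro k
    rw [spinorCoeff, ← coeff_map]
    simp
  simp only [hc, finsetSum_coeff, coeff_mul_C] at h
  have hn (m : ℕ) (f : R[X]) : ((m : R[X]) * f).coeff l = (m : R) * f.coeff l := by
    rw [← C_eq_natCast, coeff_C_mul]
  simp only [hn] at h
  have e1 : (C p + X * C r) * C p' + (C q + X * C t) * C q' =
      C (p * p' + q * q') + X * C (r * p' + t * q') := by
    simp only [map_add, map_mul]; ring
  have e2 : (C p + X * C r) * C r' + (C q + X * C t) * C t' =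
      C (p * r' + q * t') + X * C (r * r' + t * t') := by
    simp only [map_add, map_mul]; ring
  rw [e1, e2, coeff_linear_pow_mul] at h
  exact h

lemma map_spinorCoeff {S : Type*} [CommRing S] (f : R →+* S) (p q r t : R) (l k : ℕ) :
    f (spinorCoeff l k p q r t) = spinorCoeff l k (f p) (f q) (f r) (f t) := by
  rw [spinorCoeff, spinorCoeff, ← coeff_map]
  simp

end LinearFormPowers

open ComplexConjugate

/-- A lift through the Hopf map with $\alpha\ge0$ real; the south pole, where $\alpha=0$, is
separate. -/
lemma exists_spinor {x y z : ℝ} (h : x ^ 2 + y ^ 2 + z ^ 2 = 1) :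
    ∃ α β : ℂ, α * conj α + β * conj β = 1 ∧ α * conj α - β * conj β = z ∧
      2 * (conj α * β) = x + y * Complex.I := by
  by_cases hz : z = -1
  · have hx : x = 0 := by nlinarith [sq_nonneg x, sq_nonneg y]
    have hy : y = 0 := by nlinarith [sq_nonneg x, sq_nonneg y]
    exact ⟨0, 1, by simp, by simp [hz], by simp [hx, hy]⟩
  have hz1 : -1 < z := lt_of_le_of_ne (by nlinarith [sq_nonneg x, sq_nonneg y]) (Ne.symm hz)
  set a : ℝ := √((1 + z) / 2) with ha
  have ha2 : a ^ 2 = (1 + z) / 2 := Real.sq_sqrt (by linarith)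
  have ha0 : 0 < a := Real.sqrt_pos.mpr (by linarith)
  have hb : (x / (2 * a)) ^ 2 + (y / (2 * a)) ^ 2 = (1 - z) / 2 := by
    have : (x / (2 * a)) ^ 2 + (y / (2 * a)) ^ 2 = (x ^ 2 + y ^ 2) / (4 * a ^ 2) := by
      field_simp; ring
    rw [this, ha2, div_eq_iff (by linarith)]
    nlinarith
  refine ⟨a, ⟨x / (2 * a), y / (2 * a)⟩, ?_, ?_, ?_⟩
  · rw [Complex.mul_conj, Complex.mul_conj, Complex.normSq_ofReal, Complex.normSq_mk]
    norm_cast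
    nlinarith
  · rw [Complex.mul_conj, Complex.mul_conj, Complex.normSq_ofReal, Complex.normSq_mk]
    norm_cast
    nlinarith
  · apply Complex.ext
    · simp; field_simp
    · simp; field_simp

/-- The addition theorem for spin $l$. The two products occurring are
$|\langle\psi,\psi'\rangle|^2=(1+\cos\theta)/2$ and $-|\det(\psi,\psi')|^2=(\cos\theta-1)/2$. -/
lemma spinor_legendre {α β α' β' : ℂ} {x y z x' y' z' : ℝ}
    (h1 : α * conj α + β * conj β = 1) (h2 : α * conj α - β * conj β = z)
    (h3 : 2 * (conj α * β) = x + y * Complex.I)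
    (h1' : α' * conj α' + β' * conj β' = 1) (h2' : α' * conj α' - β' * conj β' = z')
    (h3' : 2 * (conj α' * β') = x' + y' * Complex.I) (l : ℕ) :
    ∑ k ∈ range (2 * l + 1), ((2 * l).choose k : ℂ) *
        spinorCoeff l k α β (-conj β) (conj α) *
        conj (spinorCoeff l k α' β' (-conj β') (conj α')) =
      (((2 * l).choose l * legendre l (x * x' + y * y' + z * z') : ℝ) : ℂ) := by
  have h4 : 2 * (α * conj β) = x - y * Complex.I := by
    have := congrArg conj h3
    simpa [sub_eq_add_neg, map_ofNat] using this
  have h4' : 2 * (α' * conj β') = x' - y' * Complex.I := by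
    have := congrArg conj h3'
    simpa [sub_eq_add_neg, map_ofNat] using this
  simp only [map_spinorCoeff, sum_spinorCoeff_mul, map_neg, Complex.conj_conj]
  rw [legendre]
  push_cast
  have hI : Complex.I ^ 2 = -1 := Complex.I_sq
  have e1 : (α * conj α' + β * conj β') * (-conj β * -β' + conj α * α') =
      (1 + (x * x' + y * y' + z * z')) / 2 := by
    have a1 : α * conj α = (1 + z) / 2 := by linear_combination (h1 + h2) / 2
    have b1 : β * conj β = (1 - z) / 2 := by linear_combination (h1 - h2) / 2
    have a1' : α' * conj α' = (1 + z') / 2 := by linear_combination (h1' + h2') / 2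
    have b1' : β' * conj β' = (1 - z') / 2 := by linear_combination (h1' - h2') / 2
    have c1 : conj α * β = (x + y * Complex.I) / 2 := by linear_combination h3 / 2
    have d1 : α * conj β = (x - y * Complex.I) / 2 := by linear_combination h4 / 2
    have c1' : conj α' * β' = (x' + y' * Complex.I) / 2 := by linear_combination h3' / 2
    have d1' : α' * conj β' = (x' - y' * Complex.I) / 2 := by linear_combination h4' / 2
    have : (α * conj α' + β * conj β') * (-conj β * -β' + conj α * α') =
        (α * conj α) * (α' * conj α') + (β * conj β) * (β' * conj β') +
        (α * conj β) * (conj α' * β') + (conj α * β) * (α' * conj β') := by ring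
    rw [this, a1, b1, a1', b1', c1, d1, c1', d1']
    linear_combination (-(y : ℂ) * y' / 2) * hI
  have e2 : (-conj β * conj α' + conj α * conj β') * (α * -β' + β * α') =
      (x * x' + y * y' + z * z' - 1) / 2 := by
    linear_combination e1 - (α' * conj α' + β' * conj β') * h1 - h1'
  rw [e1, e2]

/-- By the addition theorem, $\binom{2l}{l}$ times the form is a nonnegative combination of squared
moduli. -/
lemma legendre_posSemidef (l : ℕ) {ι : Type*} (s : Finset ι) (u : ι → E3)
    (hu : ∀ i ∈ s, ‖u i‖ = 1) (c : ι → ℝ) :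
    0 ≤ ∑ i ∈ s, ∑ j ∈ s, c i * c j * legendre l (inner ℝ (u i) (u j)) := by
  have hex : ∀ i : ι, ∃ p : ℂ × ℂ, i ∈ s → p.1 * conj p.1 + p.2 * conj p.2 = 1 ∧
      p.1 * conj p.1 - p.2 * conj p.2 = ((u i 2 : ℝ) : ℂ) ∧
      2 * (conj p.1 * p.2) = ((u i 0 : ℝ) : ℂ) + ((u i 1 : ℝ) : ℂ) * Complex.I := by
    intro i
    by_cases hi : i ∈ s
    · have h := hu i hi
      rw [EuclideanSpace.norm_eq, Real.sqrt_eq_one, Fin.sum_univ_three] at h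
      simp only [Real.norm_eq_abs, sq_abs] at h
      obtain ⟨α, β, hab⟩ := exists_spinor h
      exact ⟨(α, β), fun _ => hab⟩
    · exact ⟨0, fun h => absurd h hi⟩
  choose p hp using hex
  set T : ℕ → ι → ℂ := fun k i =>
    spinorCoeff l k (p i).1 (p i).2 (-conj (p i).2) (conj (p i).1) with hT
  have key : (((2 * l).choose l * ∑ i ∈ s, ∑ j ∈ s,
      c i * c j * legendre l (inner ℝ (u i) (u j)) : ℝ) : ℂ) =
      ((∑ k ∈ range (2 * l + 1), (2 * l).choose k * Complex.normSq (∑ i ∈ s, c i * T k i) : ℝ) :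
        ℂ) := by
    have e : ∀ i ∈ s, ∀ j ∈ s, (((2 * l).choose l : ℝ) : ℂ) *
        ((c i * c j * legendre l (inner ℝ (u i) (u j)) : ℝ) : ℂ) =
        ∑ k ∈ range (2 * l + 1), ((2 * l).choose k : ℂ) *
          ((c i * T k i) * (c j * conj (T k j))) := by
      intro i hi j hj
      obtain ⟨h1, h2, h3⟩ := hp i hi
      obtain ⟨h1', h2', h3'⟩ := hp j hj
      have h := spinor_legendre h1 h2 h3 h1' h2' h3' l
      have hin : inner ℝ (u i) (u j) = u i 0 * u j 0 + u i 1 * u j 1 + u i 2 * u j 2 := by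
        simp [PiLp.inner_apply, Fin.sum_univ_three, mul_comm]
      rw [hin]
      calc _ = (c i : ℂ) * c j * (((2 * l).choose l *
              legendre l (u i 0 * u j 0 + u i 1 * u j 1 + u i 2 * u j 2) : ℝ) : ℂ) := by
            push_cast; ring
        _ = _ := by
            rw [← h, mul_sum]
            exact sum_congr rfl fun k _ => by ring
    rw [Complex.ofReal_mul, Complex.ofReal_sum, mul_sum, Complex.ofReal_sum]
    calc _ = ∑ i ∈ s, ∑ j ∈ s, ∑ k ∈ range (2 * l + 1), ((2 * l).choose k : ℂ) *
          ((c i * T k i) * (c j * conj (T k j))) := by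
          refine sum_congr rfl fun i hi => ?_
          rw [Complex.ofReal_sum, mul_sum]
          exact sum_congr rfl fun j hj => e i hi j hj
      _ = ∑ k ∈ range (2 * l + 1), ∑ i ∈ s, ∑ j ∈ s, ((2 * l).choose k : ℂ) *
          ((c i * T k i) * (c j * conj (T k j))) := by
          rw [sum_comm (s := range (2 * l + 1))]
          exact sum_congr rfl fun i _ => sum_comm
      _ = _ := by
          refine sum_congr rfl fun k _ => ?_
          rw [Complex.ofReal_mul, ← Complex.mul_conj, map_sum, sum_mul_sum, mul_sum]
          refine sum_congr rfl fun i _ => ?_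
          rw [mul_sum]
          exact sum_congr rfl fun j _ => by simp
  have key' := Complex.ofReal_injective key
  have hpos : (0 : ℝ) < (2 * l).choose l := by
    exact_mod_cast Nat.choose_pos (by omega)
  refine nonneg_of_mul_nonneg_right (a := ((2 * l).choose l : ℝ)) ?_ hpos
  rw [key']
  exact sum_nonneg fun k _ => mul_nonneg (Nat.cast_nonneg _) (Complex.normSq_nonneg _)

/-- Semidefiniteness on two points with weights $(1,\pm1)$ reads $2\pm2P_l\ge0$. -/
lemma abs_legendre_inner_le_one (l : ℕ) {u v : E3} (hu : ‖u‖ = 1) (hv : ‖v‖ = 1) :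
    |legendre l (inner ℝ u v)| ≤ 1 := by
  have h (e : ℝ) := legendre_posSemidef l (univ : Finset (Fin 2)) ![u, v]
    (by intro i _; fin_cases i <;> simp [hu, hv]) ![1, e]
  simp only [Fin.sum_univ_two, Matrix.cons_val_zero, Matrix.cons_val_one,
    real_inner_self_eq_norm_sq, hu, hv, one_pow, legendre_one_right, real_inner_comm u v] at h
  rw [abs_le]
  constructor
  · have := h 1; linarith
  · have := h (-1); linarith

end CoulombMeanField

/-! ### Multipole expansion of the nonradial kernel. -/

namespace CoulombMeanField

open Finset

lemma integral_indicator_mul_indicator {a b : ℝ} (ha : 0 ≤ a) (hb : 0 ≤ b) :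
    Integrable (fun τ => (Set.Ico 0 a).indicator (1 : ℝ → ℝ) τ *
        (Set.Ico 0 b).indicator (1 : ℝ → ℝ) τ) ∧
      ∫ τ, (Set.Ico 0 a).indicator (1 : ℝ → ℝ) τ * (Set.Ico 0 b).indicator (1 : ℝ → ℝ) τ =
        min a b := by
  have e : (fun τ => (Set.Ico 0 a).indicator (1 : ℝ → ℝ) τ *
      (Set.Ico 0 b).indicator (1 : ℝ → ℝ) τ) = (Set.Ico 0 (min a b)).indicator 1 := by
    rw [show Set.Ico 0 (min a b) = Set.Ico 0 a ∩ Set.Ico 0 b by simp [Set.Ico_inter_Ico],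
      Set.inter_indicator_one]
    rfl
  rw [e]
  constructor
  · exact (integrable_indicator_iff measurableSet_Ico).mpr
      (integrableOn_const (C := (1 : ℝ)) measure_Ico_lt_top.ne)
  · rw [integral_indicator_one measurableSet_Ico]
    simp [ha, hb]

/-- Layer cake: $\min(A_i,A_j)=\int 1_{[0,A_i)}1_{[0,A_j)}\,d\tau$, so each $\tau$ merely rescales
the weights $c_i$. -/
lemma sum_mul_min_nonneg {ι : Type*} (s : Finset ι) (M : ι → ι → ℝ) (A : ι → ℝ)
    (hA : ∀ i ∈ s, 0 ≤ A i)
    (hM : ∀ c : ι → ℝ, 0 ≤ ∑ i ∈ s, ∑ j ∈ s, c i * c j * M i j) (c : ι → ℝ) :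
    0 ≤ ∑ i ∈ s, ∑ j ∈ s, c i * c j * (min (A i) (A j) * M i j) := by
  set χ : ι → ℝ → ℝ := fun i => (Set.Ico 0 (A i)).indicator 1 with hχ
  have hint : ∀ i ∈ s, ∀ j ∈ s, Integrable (fun τ => c i * c j * M i j * (χ i τ * χ j τ)) :=
    fun i hi j hj => (integral_indicator_mul_indicator (hA i hi) (hA j hj)).1.const_mul _
  have e : ∑ i ∈ s, ∑ j ∈ s, c i * c j * (min (A i) (A j) * M i j) =
      ∫ τ, ∑ i ∈ s, ∑ j ∈ s, c i * c j * M i j * (χ i τ * χ j τ) := by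
    rw [integral_finsetSum _ fun i hi => integrable_finsetSum _ (hint i hi)]
    refine sum_congr rfl fun i hi => ?_
    rw [integral_finsetSum _ (hint i hi)]
    refine sum_congr rfl fun j hj => ?_
    rw [integral_const_mul, (integral_indicator_mul_indicator (hA i hi) (hA j hj)).2]
    ring
  rw [e]
  refine integral_nonneg fun τ => ?_
  refine le_of_le_of_eq (hM fun i => c i * χ i τ) ?_
  exact sum_congr rfl fun i _ => sum_congr rfl fun j _ => by ring

/-- The weighted difference between the Coulomb kernel, with its `l`-th multipole damped by
`ρ ^ l`, and its spherical average. -/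
noncomputable def nonradialKernel (s ρ : ℝ) (x y : E3) : ℝ :=
  (‖x‖ ^ s + ‖y‖ ^ s) *
    ((√(max ‖x‖ ‖y‖ ^ 2 - 2 * ρ * inner ℝ x y + ρ ^ 2 * min ‖x‖ ‖y‖ ^ 2))⁻¹ - (max ‖x‖ ‖y‖)⁻¹)

/-- The cosine of the angle between two vectors, as an inner product of unit vectors. -/
noncomputable def cosine (x y : E3) : ℝ := inner ℝ (‖x‖⁻¹ • x) (‖y‖⁻¹ • y)

/-- The `l`-th multipole of `nonradialKernel`. -/
noncomputable def multipole (s ρ : ℝ) (l : ℕ) (x y : E3) : ℝ :=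
  ρ ^ l * ((max ‖x‖ ‖y‖ ^ (s - 1 - l) * min ‖x‖ ‖y‖ ^ (l : ℝ) +
    min ‖x‖ ‖y‖ ^ (s + l) * max ‖x‖ ‖y‖ ^ (-1 - l : ℝ)) * legendre l (cosine x y))

lemma norm_unit {x : E3} (hx : x ≠ 0) : ‖‖x‖⁻¹ • x‖ = 1 := by
  rw [norm_smul, norm_inv, norm_norm, inv_mul_cancel₀ (norm_ne_zero_iff.mpr hx)]

lemma norm_mul_norm_mul_cosine {x y : E3} (hx : x ≠ 0) (hy : y ≠ 0) :
    ‖x‖ * ‖y‖ * cosine x y = inner ℝ x y := by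
  have hx' := norm_ne_zero_iff.mpr hx
  have hy' := norm_ne_zero_iff.mpr hy
  rw [cosine, real_inner_smul_left, real_inner_smul_right]
  field_simp

/-- The generating function at $q=\rho\min/\max<1$; the omitted $l=0$ term is the subtracted
spherical average. -/
lemma hasSum_multipole {s ρ : ℝ} (hρ0 : 0 ≤ ρ) (hρ : ρ < 1) {x y : E3} (hx : x ≠ 0)
    (hy : y ≠ 0) :
    HasSum (fun l => multipole s ρ (l + 1) x y) (nonradialKernel s ρ x y) := by
  have hx' := norm_pos_iff.mpr hx
  have hy' := norm_pos_iff.mpr hy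
  have hc := norm_mul_norm_mul_cosine hx hy
  have hP : ∀ n, |legendre n (cosine x y)| ≤ 1 := fun n =>
    abs_legendre_inner_le_one n (norm_unit hx) (norm_unit hy)
  have hsum : ‖x‖ ^ s + ‖y‖ ^ s = max ‖x‖ ‖y‖ ^ s + min ‖x‖ ‖y‖ ^ s := by
    rcases le_total ‖x‖ ‖y‖ with h | h <;> simp [h, add_comm]
  have hprod : ‖x‖ * ‖y‖ = max ‖x‖ ‖y‖ * min ‖x‖ ‖y‖ := (max_mul_min _ _).symm
  rw [nonradialKernel, hsum]
  rw [hprod] at hc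
  have hmul : ∀ l, multipole s ρ l x y = ρ ^ l * ((max ‖x‖ ‖y‖ ^ (s - 1 - l) *
    min ‖x‖ ‖y‖ ^ (l : ℝ) + min ‖x‖ ‖y‖ ^ (s + l) * max ‖x‖ ‖y‖ ^ (-1 - l : ℝ)) *
      legendre l (cosine x y)) := fun l => rfl
  have hR : 0 < max ‖x‖ ‖y‖ := lt_max_of_lt_left hx'
  have hr : 0 < min ‖x‖ ‖y‖ := lt_min hx' hy'
  have hle : min ‖x‖ ‖y‖ ≤ max ‖x‖ ‖y‖ := min_le_max
  generalize max ‖x‖ ‖y‖ = R at *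
  generalize min ‖x‖ ‖y‖ = r at *
  generalize cosine x y = c at *
  set q : ℝ := ρ * r / R with hq
  have hq0 : 0 ≤ q := by positivity
  have hq1 : q < 1 := by
    rw [hq, div_lt_one hR]
    nlinarith
  have hterm : ∀ l, multipole s ρ l x y = (R ^ s + r ^ s) * R⁻¹ * (legendre l c * q ^ l) := by
    intro l
    rw [hmul, show s - 1 - (l : ℝ) = s - (1 + l) by ring, Real.rpow_sub hR, Real.rpow_add hr,
      show (-1 - (l : ℝ)) = -(1 + l) by ring, Real.rpow_neg hR.le, Real.rpow_add hR,
      Real.rpow_one, Real.rpow_natCast, Real.rpow_natCast, hq, div_pow, mul_pow]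
    field_simp
  have h := (summable_legendre hP hq0 hq1).of_norm.hasSum
  rw [legendre_tsum hP hq0 hq1] at h
  have hroot : √(R ^ 2 - 2 * ρ * inner ℝ x y + ρ ^ 2 * r ^ 2) =
      R * √(1 - 2 * c * q + q ^ 2) := by
    rw [← Real.sqrt_sq hR.le, ← Real.sqrt_mul (sq_nonneg R), Real.sqrt_sq hR.le, ← hc, hq]
    congr 1
    field_simp
  rw [hroot, mul_inv]
  have h1 := ((hasSum_nat_add_iff' 1).mpr h).mul_left ((R ^ s + r ^ s) * R⁻¹)
  simp only [hterm]
  convert! h1 using 1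
  simp [legendre_zero]
  ring

lemma multipole_factor {s ρ : ℝ} {l : ℕ} (hl : 0 ≤ 2 * (l : ℝ) + 1 - s) (hs : 0 < s) {x y : E3}
    (hx : x ≠ 0) (hy : y ≠ 0) :
    multipole s ρ l x y = ρ ^ l *
      (‖x‖ ^ (s - 1 - l) * ‖y‖ ^ (s - 1 - l) *
        (min (‖x‖ ^ (2 * (l : ℝ) + 1 - s)) (‖y‖ ^ (2 * (l : ℝ) + 1 - s)) *
          legendre l (cosine x y)) +
      ‖x‖ ^ (-1 - l : ℝ) * ‖y‖ ^ (-1 - l : ℝ) *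
        (min (‖x‖ ^ (2 * (l : ℝ) + 1 + s)) (‖y‖ ^ (2 * (l : ℝ) + 1 + s)) *
          legendre l (cosine x y))) := by
  have hx' := norm_pos_iff.mpr hx
  have hy' := norm_pos_iff.mpr hy
  have hmin : ∀ p : ℝ, 0 ≤ p → min (‖x‖ ^ p) (‖y‖ ^ p) = min ‖x‖ ‖y‖ ^ p := by
    intro p hp
    rcases le_total ‖x‖ ‖y‖ with h | h
    · rw [min_eq_left h, min_eq_left (Real.rpow_le_rpow hx'.le h hp)]
    · rw [min_eq_right h, min_eq_right (Real.rpow_le_rpow hy'.le h hp)]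
  have hprod : ∀ p : ℝ, ‖x‖ ^ p * ‖y‖ ^ p = max ‖x‖ ‖y‖ ^ p * min ‖x‖ ‖y‖ ^ p := by
    intro p
    rw [← Real.mul_rpow hx'.le hy'.le, ← max_mul_min,
      Real.mul_rpow (le_max_of_le_left hx'.le) (le_min hx'.le hy'.le)]
  have hr : 0 < min ‖x‖ ‖y‖ := lt_min hx' hy'
  rw [hmin _ hl, hmin _ (by positivity), hprod, hprod, multipole]
  have e1 : min ‖x‖ ‖y‖ ^ (l : ℝ) =
      min ‖x‖ ‖y‖ ^ (s - 1 - l) * min ‖x‖ ‖y‖ ^ (2 * (l : ℝ) + 1 - s) := by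
    rw [← Real.rpow_add hr]; ring_nf
  have e2 : min ‖x‖ ‖y‖ ^ (s + l) =
      min ‖x‖ ‖y‖ ^ (-1 - l : ℝ) * min ‖x‖ ‖y‖ ^ (2 * (l : ℝ) + 1 + s) := by
    rw [← Real.rpow_add hr]; ring_nf
  rw [e1, e2]
  ring

lemma sum_multipole_nonneg {s ρ : ℝ} {l : ℕ} (hρ : 0 ≤ ρ) (hl : 0 ≤ 2 * (l : ℝ) + 1 - s)
    (hs : 0 < s) {ι : Type*} (t : Finset ι) (x : ι → E3) (hx : ∀ i ∈ t, x i ≠ 0) :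
    0 ≤ ∑ i ∈ t, ∑ j ∈ t, multipole s ρ l (x i) (x j) := by
  have hM := legendre_posSemidef l t (fun i => ‖x i‖⁻¹ • x i) fun i hi => norm_unit (hx i hi)
  have h1 := sum_mul_min_nonneg t _ (fun i => ‖x i‖ ^ (2 * (l : ℝ) + 1 - s))
    (fun i _ => by positivity) hM (fun i => ‖x i‖ ^ (s - 1 - l))
  have h2 := sum_mul_min_nonneg t _ (fun i => ‖x i‖ ^ (2 * (l : ℝ) + 1 + s))
    (fun i _ => by positivity) hM (fun i => ‖x i‖ ^ (-1 - l : ℝ))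
  refine le_of_le_of_eq (mul_nonneg (pow_nonneg hρ l) (add_nonneg h1 h2)) ?_
  rw [← sum_add_distrib, mul_sum]
  refine sum_congr rfl fun i hi => ?_
  rw [← sum_add_distrib, mul_sum]
  exact sum_congr rfl fun j hj => (multipole_factor hl hs (hx i hi) (hx j hj)).symm

lemma nonradialKernel_zero_left {s ρ : ℝ} (y : E3) : nonradialKernel s ρ 0 y = 0 := by
  simp [nonradialKernel]

lemma nonradialKernel_zero_right {s ρ : ℝ} (x : E3) : nonradialKernel s ρ x 0 = 0 := by
  simp [nonradialKernel]

lemma sum_nonradialKernel_nonneg {s ρ : ℝ} (hs : 1 < s) (hs3 : s ≤ 3) (hρ0 : 0 ≤ ρ)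
    (hρ : ρ < 1) {n : ℕ} (x : Fin n → E3) :
    0 ≤ ∑ i, ∑ j, nonradialKernel s ρ (x i) (x j) := by
  classical
  set t : Finset (Fin n) := univ.filter fun i => x i ≠ 0 with ht
  have hx : ∀ i ∈ t, x i ≠ 0 := fun i hi => (mem_filter.mp hi).2
  have hz : ∀ i ∉ t, x i = 0 := fun i hi => by simpa [ht] using hi
  have e : ∑ i, ∑ j, nonradialKernel s ρ (x i) (x j) =
      ∑ i ∈ t, ∑ j ∈ t, nonradialKernel s ρ (x i) (x j) := by
    symm
    calc _ = ∑ i ∈ t, ∑ j, nonradialKernel s ρ (x i) (x j) :=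
          sum_congr rfl fun i _ => sum_subset (subset_univ t) fun j _ hj => by
            rw [hz j hj, nonradialKernel_zero_right]
      _ = _ := sum_subset (subset_univ t) fun i _ hi => by
            simp [hz i hi, nonradialKernel_zero_left]
  rw [e]
  have hsum : HasSum (fun l => ∑ i ∈ t, ∑ j ∈ t, multipole s ρ (l + 1) (x i) (x j))
      (∑ i ∈ t, ∑ j ∈ t, nonradialKernel s ρ (x i) (x j)) :=
    hasSum_sum fun i hi => hasSum_sum fun j hj => hasSum_multipole hρ0 hρ (hx i hi) (hx j hj)
  refine hsum.nonneg fun l => sum_multipole_nonneg hρ0 ?_ (by linarith) t x hx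
  -- The smallest exponent occurs at multipole 1 and is $3-s$; here `hs3` enters.
  push_cast
  have : (0 : ℝ) ≤ l := Nat.cast_nonneg l
  linarith

end CoulombMeanField

/-! ### From finite configurations to measures. -/

namespace CoulombMeanField

open ProbabilityTheory in
lemma map_eval_prod_eval {α : Type*} [MeasurableSpace α] (μ : Measure α) [IsProbabilityMeasure μ]
    {n : ℕ} {i j : Fin n} (hij : i ≠ j) :
    (Measure.pi fun _ : Fin n => μ).map (fun x => (x i, x j)) = μ.prod μ := by
  have h := (iIndepFun_pi (μ := fun _ : Fin n => μ) (X := fun _ x => x)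
    fun _ => aemeasurable_id').indepFun hij
  have h2 := (indepFun_iff_map_prod_eq_prod_map_map (measurable_pi_apply i).aemeasurable
    (measurable_pi_apply j).aemeasurable).mp h
  rwa [(measurePreserving_eval (fun _ : Fin n => μ) i).map_eq,
    (measurePreserving_eval (fun _ : Fin n => μ) j).map_eq] at h2

/-- Averaging over $n$ independent samples gives $nD+n(n-1)I\ge0$; for large $n$ the diagonal term
$D$ is negligible. -/
lemma integral_prod_nonneg_of_sum_nonneg {α : Type*} [MeasurableSpace α] (μ : Measure α)
    [IsProbabilityMeasure μ] {K : α → α → ℝ}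
    (hK : Integrable (fun p : α × α => K p.1 p.2) (μ.prod μ))
    (hd : Integrable (fun x => K x x) μ)
    (hpos : ∀ (n : ℕ) (x : Fin n → α), 0 ≤ ∑ i, ∑ j, K (x i) (x j)) :
    0 ≤ ∫ p, K p.1 p.2 ∂(μ.prod μ) := by
  set I := ∫ p, K p.1 p.2 ∂(μ.prod μ) with hI
  set D := ∫ x, K x x ∂μ with hD
  have key : ∀ n : ℕ, 0 ≤ n * (D + (n - 1) * I) := by
    intro n
    set ν := Measure.pi fun _ : Fin n => μ with hν
    have hterm : ∀ i j : Fin n, Integrable (fun x => K (x i) (x j)) ν ∧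
        ∫ x, K (x i) (x j) ∂ν = if i = j then D else I := by
      intro i j
      by_cases hij : i = j
      · subst hij
        have hmp := measurePreserving_eval (fun _ : Fin n => μ) i
        rw [← hmp.map_eq] at hd
        refine ⟨hd.comp_measurable (measurable_pi_apply i), ?_⟩
        rw [if_pos rfl, hD, ← hmp.map_eq,
          integral_map (measurable_pi_apply i).aemeasurable hd.aestronglyMeasurable]
      · have hm : Measurable (fun x : Fin n → α => (x i, x j)) := by fun_prop
        have hmap := map_eval_prod_eval μ hij
        rw [← hmap] at hK
        refine ⟨hK.comp_measurable hm, ?_⟩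
        rw [if_neg hij, hI, ← hmap, integral_map hm.aemeasurable hK.aestronglyMeasurable]
    have h := integral_nonneg (μ := ν) (f := fun x => ∑ i, ∑ j, K (x i) (x j)) (hpos n)
    rw [integral_finsetSum _ fun i _ => integrable_finsetSum _ fun j _ => (hterm i j).1] at h
    have e : ∀ i : Fin n, ∫ x, ∑ j, K (x i) (x j) ∂ν = D + (n - 1) * I := by
      intro i
      rw [integral_finsetSum _ fun j _ => (hterm i j).1]
      simp only [(hterm i _).2]
      have : ∀ j : Fin n, (if i = j then D else I) = I + if i = j then D - I else 0 := by
        intro j; split_ifs <;> ring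
      simp only [this, Finset.sum_add_distrib, Finset.sum_ite_eq, Finset.mem_univ, if_true,
        Finset.sum_const, Finset.card_univ, Fintype.card_fin, nsmul_eq_mul]
      ring
    simp only [e, Finset.sum_const, Finset.card_univ, Fintype.card_fin, nsmul_eq_mul] at h
    exact h
  by_contra! hneg
  obtain ⟨m, hm⟩ := exists_nat_gt (D / -I)
  rw [div_lt_iff₀ (by linarith)] at hm
  have h := key (m + 1)
  push_cast at h
  have hm0 : (0 : ℝ) ≤ m := Nat.cast_nonneg m
  nlinarith

/-! ### Pointwise bounds for the damped kernel. -/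

section Pointwise

variable {s ρ : ℝ} (x y : E3)

/-- The distance between `x` and `y`, damped in the multipole expansion. -/
noncomputable def dampedDist (ρ : ℝ) (x y : E3) : ℝ :=
  √(max ‖x‖ ‖y‖ ^ 2 - 2 * ρ * inner ℝ x y + ρ ^ 2 * min ‖x‖ ‖y‖ ^ 2)

lemma norm_sub_sq_eq_max_min :
    ‖x - y‖ ^ 2 = max ‖x‖ ‖y‖ ^ 2 - 2 * inner ℝ x y + min ‖x‖ ‖y‖ ^ 2 := by
  rw [norm_sub_sq_real]
  rcases le_total ‖x‖ ‖y‖ with h | h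
  · rw [max_eq_right h, min_eq_left h]; ring
  · rw [max_eq_left h, min_eq_right h]

/-- With $R,r$ the larger and smaller norm, the squares differ by $(1-\rho)(R^2-\rho r^2)\ge0$. -/
lemma sqrt_mul_norm_sub_le (hρ0 : 0 ≤ ρ) (hρ : ρ ≤ 1) :
    √ρ * ‖x - y‖ ≤ dampedDist ρ x y := by
  refine Real.le_sqrt_of_sq_le ?_
  rw [mul_pow, Real.sq_sqrt hρ0, norm_sub_sq_eq_max_min]
  have h1 : min ‖x‖ ‖y‖ ^ 2 ≤ max ‖x‖ ‖y‖ ^ 2 :=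
    pow_le_pow_left₀ (le_min (norm_nonneg _) (norm_nonneg _)) min_le_max 2
  have h2 : 0 ≤ (1 - ρ) * (max ‖x‖ ‖y‖ ^ 2 - ρ * min ‖x‖ ‖y‖ ^ 2) := by
    refine mul_nonneg (by linarith) ?_
    nlinarith [sq_nonneg (min ‖x‖ ‖y‖)]
  nlinarith

/-- The damped distance is at least $R-\rho r$; this removes the diagonal singularity away from the
origin. -/
lemma mul_max_norm_le_dampedDist (hρ0 : 0 ≤ ρ) (hρ : ρ ≤ 1) :
    (1 - ρ) * max ‖x‖ ‖y‖ ≤ dampedDist ρ x y := by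
  refine Real.le_sqrt_of_sq_le ?_
  have h1 : inner ℝ x y ≤ max ‖x‖ ‖y‖ * min ‖x‖ ‖y‖ := by
    rw [max_mul_min]; exact real_inner_le_norm x y
  have h2 : 0 ≤ min ‖x‖ ‖y‖ := le_min (norm_nonneg _) (norm_nonneg _)
  have h3 : min ‖x‖ ‖y‖ ≤ max ‖x‖ ‖y‖ := min_le_max
  generalize max ‖x‖ ‖y‖ = R at *
  generalize min ‖x‖ ‖y‖ = r at *
  have h4 : ρ * inner ℝ x y ≤ ρ * (R * r) := by gcongr
  have h5 : (1 - ρ) * R ≤ R - ρ * r := by nlinarith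
  have h6 : 0 ≤ (1 - ρ) * R := mul_nonneg (by linarith) (by linarith)
  have h7 := pow_le_pow_left₀ h6 h5 2
  nlinarith

lemma weight_mul_inv_max_le (hs : 1 < s) :
    (‖x‖ ^ s + ‖y‖ ^ s) * (max ‖x‖ ‖y‖)⁻¹ ≤ 2 * (‖x‖ ^ (s - 1) + ‖y‖ ^ (s - 1)) := by
  have hx := norm_nonneg x
  have hy := norm_nonneg y
  have hs0 : 0 ≤ s := by linarith
  rcases (le_max_of_le_left hx : 0 ≤ max ‖x‖ ‖y‖).eq_or_lt with h0 | hR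
  · rw [← h0, inv_zero, mul_zero]; positivity
  have hR1 : max ‖x‖ ‖y‖ ^ (s - 1) ≤ ‖x‖ ^ (s - 1) + ‖y‖ ^ (s - 1) := by
    have := Real.rpow_nonneg hx (s - 1)
    have := Real.rpow_nonneg hy (s - 1)
    rcases le_total ‖x‖ ‖y‖ with h | h
    · rw [max_eq_right h]; linarith
    · rw [max_eq_left h]; linarith
  have h1 : ‖x‖ ^ s ≤ max ‖x‖ ‖y‖ ^ s := Real.rpow_le_rpow hx (le_max_left _ _) hs0
  have h2 : ‖y‖ ^ s ≤ max ‖x‖ ‖y‖ ^ s := Real.rpow_le_rpow hy (le_max_right _ _) hs0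
  rw [Real.rpow_sub_one hR.ne', div_eq_mul_inv] at hR1
  have hRi : 0 ≤ (max ‖x‖ ‖y‖)⁻¹ := by positivity
  calc (‖x‖ ^ s + ‖y‖ ^ s) * (max ‖x‖ ‖y‖)⁻¹
      ≤ (2 * max ‖x‖ ‖y‖ ^ s) * (max ‖x‖ ‖y‖)⁻¹ := by
        refine mul_le_mul_of_nonneg_right (by linarith) hRi
    _ ≤ _ := by linarith

lemma weight_mul_inv_dampedDist_le (hs : 1 < s) (hρ0 : 0 ≤ ρ) (hρ : ρ < 1) :
    (‖x‖ ^ s + ‖y‖ ^ s) * (dampedDist ρ x y)⁻¹ ≤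
      2 / (1 - ρ) * (‖x‖ ^ (s - 1) + ‖y‖ ^ (s - 1)) := by
  have h1ρ : 0 < 1 - ρ := by linarith
  rcases (le_max_of_le_left (norm_nonneg x) : 0 ≤ max ‖x‖ ‖y‖).eq_or_lt with h0 | hR
  · have hx : ‖x‖ = 0 := le_antisymm (h0 ▸ le_max_left _ _) (norm_nonneg x)
    have hy : ‖y‖ = 0 := le_antisymm (h0 ▸ le_max_right _ _) (norm_nonneg y)
    rw [hx, hy, Real.zero_rpow (by linarith), Real.zero_rpow (by linarith)]
    simp
  have h := mul_max_norm_le_dampedDist x y hρ0 hρ.le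
  calc (‖x‖ ^ s + ‖y‖ ^ s) * (dampedDist ρ x y)⁻¹
      ≤ (‖x‖ ^ s + ‖y‖ ^ s) * ((1 - ρ) * max ‖x‖ ‖y‖)⁻¹ := by gcongr
    _ = (1 - ρ)⁻¹ * ((‖x‖ ^ s + ‖y‖ ^ s) * (max ‖x‖ ‖y‖)⁻¹) := by rw [mul_inv]; ring
    _ ≤ (1 - ρ)⁻¹ * (2 * (‖x‖ ^ (s - 1) + ‖y‖ ^ (s - 1))) := by
        exact mul_le_mul_of_nonneg_left (weight_mul_inv_max_le x y hs) (by positivity)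
    _ = _ := by ring

lemma root_value_mul_le_weight {t₀ : ℝ} (hs : 1 < s) (ht₀ : 0 < t₀)
    (h : t₀ ^ s + s * t₀ + 1 - s = 0) :
    s / (s - 1) * t₀ * (‖x‖ ^ (s - 1) + ‖y‖ ^ (s - 1)) ≤
      (‖x‖ ^ s + ‖y‖ ^ s) * (max ‖x‖ ‖y‖)⁻¹ := by
  wlog hxy : ‖x‖ ≤ ‖y‖ generalizing x y
  · have := this y x (le_of_not_ge hxy)
    rwa [max_comm, add_comm (‖x‖ ^ s), add_comm (‖x‖ ^ (s - 1))]
  rw [max_eq_right hxy]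
  rcases (norm_nonneg y).eq_or_lt with h0 | hy
  · have hx : ‖x‖ = 0 := le_antisymm (h0 ▸ hxy) (norm_nonneg x)
    rw [← h0, hx, Real.zero_rpow (by linarith), Real.zero_rpow (by linarith)]
    simp
  have key := root_value_mul_le hs ht₀ h (t := ‖x‖ / ‖y‖) (by positivity)
  rw [Real.div_rpow (norm_nonneg x) hy.le, Real.div_rpow (norm_nonneg x) hy.le] at key
  have hp : 0 < ‖y‖ ^ (s - 1) := by positivity
  have key2 := mul_le_mul_of_nonneg_right key hp.le
  have e1 : s / (s - 1) * t₀ * (1 + ‖x‖ ^ (s - 1) / ‖y‖ ^ (s - 1)) * ‖y‖ ^ (s - 1) =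
      s / (s - 1) * t₀ * (‖x‖ ^ (s - 1) + ‖y‖ ^ (s - 1)) := by
    rw [mul_assoc, add_mul, div_mul_cancel₀ _ hp.ne']; ring
  have e2 : (1 + ‖x‖ ^ s / ‖y‖ ^ s) * ‖y‖ ^ (s - 1) = (‖x‖ ^ s + ‖y‖ ^ s) * ‖y‖⁻¹ := by
    have : 0 < ‖y‖ ^ s := by positivity
    rw [Real.rpow_sub_one hy.ne']
    field_simp
    ring
  rwa [e1, e2] at key2

lemma ofReal_damped_le_integrand (hs : 1 < s) (hρ0 : 0 < ρ) (hρ : ρ ≤ 1) :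
    ENNReal.ofReal (√ρ / 2 * ((‖x‖ ^ s + ‖y‖ ^ s) * (dampedDist ρ x y)⁻¹)) ≤
      (‖x‖ₑ ^ s + ‖y‖ₑ ^ s) / (2 * ‖x - y‖ₑ) := by
  have hs0 : 0 < s := by linarith
  have hw : ‖x‖ₑ ^ s + ‖y‖ₑ ^ s = ENNReal.ofReal (‖x‖ ^ s + ‖y‖ ^ s) := by
    rw [ENNReal.ofReal_add (by positivity) (by positivity),
      ← ENNReal.ofReal_rpow_of_nonneg (norm_nonneg _) hs0.le,
      ← ENNReal.ofReal_rpow_of_nonneg (norm_nonneg _) hs0.le, ofReal_norm, ofReal_norm]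
  -- On the diagonal the Coulomb integrand is infinite except at the origin, where both sides
  -- vanish.
  by_cases hxy : x = y
  · subst hxy
    by_cases hx : x = 0
    · simp [hx, Real.zero_rpow hs0.ne']
    · have : 0 < ‖x‖ := norm_pos_iff.mpr hx
      have hne : ‖x‖ₑ ^ s + ‖x‖ₑ ^ s ≠ 0 := by
        rw [hw]; exact (ENNReal.ofReal_pos.mpr (by positivity)).ne'
      simp only [sub_self, enorm_zero, mul_zero]
      rw [ENNReal.div_zero hne]
      exact le_top
  have hd : 0 < ‖x - y‖ := norm_pos_iff.mpr (sub_ne_zero.mpr hxy)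
  have h2 : (2 : ℝ≥0∞) * ‖x - y‖ₑ = ENNReal.ofReal (2 * ‖x - y‖) := by
    rw [ENNReal.ofReal_mul (by norm_num), ofReal_norm]; simp
  rw [hw, h2, ← ENNReal.ofReal_div_of_pos (by positivity)]
  refine ENNReal.ofReal_le_ofReal ?_
  have h := sqrt_mul_norm_sub_le x y hρ0.le hρ
  have hρs : 0 < √ρ := Real.sqrt_pos.mpr hρ0
  have hD : 0 < dampedDist ρ x y := lt_of_lt_of_le (by positivity) h
  have hw0 : 0 ≤ ‖x‖ ^ s + ‖y‖ ^ s := by positivity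
  rw [le_div_iff₀ (by positivity)]
  calc √ρ / 2 * ((‖x‖ ^ s + ‖y‖ ^ s) * (dampedDist ρ x y)⁻¹) * (2 * ‖x - y‖)
      = (‖x‖ ^ s + ‖y‖ ^ s) * (√ρ * ‖x - y‖ / dampedDist ρ x y) := by
        rw [div_eq_mul_inv _ (dampedDist ρ x y)]; ring
    _ ≤ (‖x‖ ^ s + ‖y‖ ^ s) * 1 := by
        gcongr
        exact (div_le_one hD).mpr h
    _ = _ := mul_one _

end Pointwise

/-! ### Assembling the lower bound. -/

lemma root_value_mul_moment_le {s t₀ : ℝ} (hs : 1 < s) (hs3 : s ≤ 3) (ht₀ : 0 < t₀)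
    (h : t₀ ^ s + s * t₀ + 1 - s = 0) (μ : Measure E3) [IsProbabilityMeasure μ]
    (hm : moment (s - 1) μ < ∞) :
    ENNReal.ofReal (s / (s - 1) * t₀) * moment (s - 1) μ ≤ interaction s μ := by
  have hs1 : 0 < s - 1 := by linarith
  set c : ℝ := s / (s - 1) * t₀ with hc
  have hc0 : 0 < c := mul_pos (div_pos (by linarith) hs1) ht₀
  have hmom : ∀ x : E3, ‖x‖ₑ ^ (s - 1) = ENNReal.ofReal (‖x‖ ^ (s - 1)) := fun x => by
    rw [← ENNReal.ofReal_rpow_of_nonneg (norm_nonneg _) hs1.le, ofReal_norm]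
  have hi : Integrable (fun x : E3 => ‖x‖ ^ (s - 1)) μ := by
    refine ⟨(by fun_prop : Measurable _).aestronglyMeasurable, ?_⟩
    rw [hasFiniteIntegral_iff_ofReal (Filter.Eventually.of_forall fun x => by positivity)]
    simpa only [moment, hmom] using hm
  have hM : moment (s - 1) μ = ENNReal.ofReal (∫ x, ‖x‖ ^ (s - 1) ∂μ) := by
    rw [ofReal_integral_eq_lintegral_ofReal hi
      (Filter.Eventually.of_forall fun x => by positivity), moment]
    simp only [hmom]
  set M := ∫ x, ‖x‖ ^ (s - 1) ∂μ with hMdef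
  have hg : Integrable (fun p : E3 × E3 => ‖p.1‖ ^ (s - 1) + ‖p.2‖ ^ (s - 1)) (μ.prod μ) :=
    (hi.comp_fst μ).add (hi.comp_snd μ)
  have hgI : ∫ p : E3 × E3, (‖p.1‖ ^ (s - 1) + ‖p.2‖ ^ (s - 1)) ∂(μ.prod μ) = 2 * M := by
    rw [integral_add (hi.comp_fst μ) (hi.comp_snd μ),
      integral_fun_fst (fun x : E3 => ‖x‖ ^ (s - 1)),
      integral_fun_snd (fun x : E3 => ‖x‖ ^ (s - 1))]
    simp [hMdef, two_mul]
  have key : ∀ ρ ∈ Set.Ioo (0 : ℝ) 1, ENNReal.ofReal (√ρ * (c * M)) ≤ interaction s μ := by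
    rintro ρ ⟨hρ0, hρ⟩
    have hDm : Measurable (fun p : E3 × E3 => dampedDist ρ p.1 p.2) := by
      unfold dampedDist; fun_prop
    have hAm : Measurable (fun p : E3 × E3 =>
        (‖p.1‖ ^ s + ‖p.2‖ ^ s) * (dampedDist ρ p.1 p.2)⁻¹) := by fun_prop
    have hA0 : ∀ p : E3 × E3, 0 ≤ (‖p.1‖ ^ s + ‖p.2‖ ^ s) * (dampedDist ρ p.1 p.2)⁻¹ :=
      fun p => mul_nonneg (by positivity) (inv_nonneg.mpr (Real.sqrt_nonneg _))
    have hA : Integrable (fun p : E3 × E3 =>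
        (‖p.1‖ ^ s + ‖p.2‖ ^ s) * (dampedDist ρ p.1 p.2)⁻¹) (μ.prod μ) := by
      refine (hg.const_mul (2 / (1 - ρ))).mono' hAm.aestronglyMeasurable
        (Filter.Eventually.of_forall fun p => ?_)
      rw [Real.norm_of_nonneg (hA0 p)]
      exact weight_mul_inv_dampedDist_le p.1 p.2 hs hρ0.le hρ
    have hB : Integrable (fun p : E3 × E3 =>
        (‖p.1‖ ^ s + ‖p.2‖ ^ s) * (max ‖p.1‖ ‖p.2‖)⁻¹) (μ.prod μ) := by
      refine (hg.const_mul 2).mono'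
        (by fun_prop : Measurable _).aestronglyMeasurable
        (Filter.Eventually.of_forall fun p => ?_)
      rw [Real.norm_of_nonneg (by positivity)]
      exact weight_mul_inv_max_le p.1 p.2 hs
    have hKeq : ∀ p : E3 × E3, nonradialKernel s ρ p.1 p.2 =
        (‖p.1‖ ^ s + ‖p.2‖ ^ s) * (dampedDist ρ p.1 p.2)⁻¹ -
          (‖p.1‖ ^ s + ‖p.2‖ ^ s) * (max ‖p.1‖ ‖p.2‖)⁻¹ := fun p => mul_sub _ _ _
    have hKd : Integrable (fun x => nonradialKernel s ρ x x) μ := by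
      have hm1 : Measurable (fun x : E3 => nonradialKernel s ρ x x) := by
        unfold nonradialKernel; fun_prop
      refine ((hi.add hi).const_mul (2 / (1 - ρ) + 2)).mono' hm1.aestronglyMeasurable
        (Filter.Eventually.of_forall fun x => ?_)
      have h1 := weight_mul_inv_dampedDist_le x x hs hρ0.le hρ
      have h2 := weight_mul_inv_max_le x x hs
      have h3 := hA0 (x, x)
      have h4 : 0 ≤ (‖x‖ ^ s + ‖x‖ ^ s) * (max ‖x‖ ‖x‖)⁻¹ := by positivity
      rw [hKeq (x, x)]
      change |_ - _| ≤ (2 / (1 - ρ) + 2) * (‖x‖ ^ (s - 1) + ‖x‖ ^ (s - 1))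
      rw [abs_le, add_mul]
      constructor <;> linarith
    have hpos : 0 ≤ ∫ p, nonradialKernel s ρ p.1 p.2 ∂(μ.prod μ) :=
      integral_prod_nonneg_of_sum_nonneg μ (by simp only [hKeq]; exact hA.sub hB) hKd
        fun n x => sum_nonradialKernel_nonneg hs hs3 hρ0.le hρ x
    simp only [hKeq] at hpos
    rw [integral_sub hA hB] at hpos
    have hlow : c * (2 * M) ≤ ∫ p : E3 × E3,
        (‖p.1‖ ^ s + ‖p.2‖ ^ s) * (max ‖p.1‖ ‖p.2‖)⁻¹ ∂(μ.prod μ) := by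
      rw [← hgI, ← integral_const_mul]
      exact integral_mono (hg.const_mul c) hB
        fun p => root_value_mul_le_weight p.1 p.2 hs ht₀ h
    calc ENNReal.ofReal (√ρ * (c * M))
        ≤ ENNReal.ofReal (∫ p : E3 × E3, √ρ / 2 *
            ((‖p.1‖ ^ s + ‖p.2‖ ^ s) * (dampedDist ρ p.1 p.2)⁻¹) ∂(μ.prod μ)) := by
          refine ENNReal.ofReal_le_ofReal ?_
          rw [integral_const_mul]
          have := mul_le_mul_of_nonneg_left (hlow.trans (sub_nonneg.mp hpos))
            (by positivity : 0 ≤ √ρ / 2)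
          linarith
      _ = ∫⁻ p : E3 × E3, ENNReal.ofReal (√ρ / 2 *
            ((‖p.1‖ ^ s + ‖p.2‖ ^ s) * (dampedDist ρ p.1 p.2)⁻¹)) ∂(μ.prod μ) :=
          ofReal_integral_eq_lintegral_ofReal (hA.const_mul _)
            (Filter.Eventually.of_forall fun p => mul_nonneg (by positivity) (hA0 p))
      _ = ∫⁻ x, ∫⁻ y, ENNReal.ofReal (√ρ / 2 *
            ((‖x‖ ^ s + ‖y‖ ^ s) * (dampedDist ρ x y)⁻¹)) ∂μ ∂μ :=
          lintegral_prod _ (hAm.const_mul _).ennreal_ofReal.aemeasurable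
      _ ≤ interaction s μ :=
          lintegral_mono fun x => lintegral_mono fun y =>
            ofReal_damped_le_integrand x y hs hρ0 hρ.le
  rw [hM, ← ENNReal.ofReal_mul hc0.le]
  -- The damped bound loses only the factor $\sqrt\rho$, so $\rho\to1$ from below suffices.
  have hcont : Continuous fun ρ : ℝ => ENNReal.ofReal (√ρ * (c * M)) :=
    ENNReal.continuous_ofReal.comp (by fun_prop)
  have hlim := (hcont.tendsto 1).mono_left (nhdsWithin_le_nhds (s := Set.Iio 1))
  rw [Real.sqrt_one, one_mul] at hlim
  refine le_of_tendsto hlim ?_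
  filter_upwards [Ioo_mem_nhdsLT (zero_lt_one' ℝ)] with ρ hρ using key ρ hρ

lemma root_value_le_beta {s t₀ : ℝ} (hs : 1 < s) (hs3 : s ≤ 3) (ht₀ : 0 < t₀)
    (h : t₀ ^ s + s * t₀ + 1 - s = 0) :
    ENNReal.ofReal (s / (s - 1) * t₀) ≤ beta s := by
  refine le_iInf₂ fun μ hμ => ?_
  -- A vanishing moment must be ruled out: the Dirac mass at the origin would give the quotient
  -- $0/0=0$.
  rw [ENNReal.le_div_iff_mul_le (Or.inl (moment_ne_zero hs hμ)) (Or.inl hμ.2.ne)]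
  exact root_value_mul_moment_le hs hs3 ht₀ h μ hμ.2

lemma inv_b_eq {s t₀ : ℝ} (hs : 1 < s) (ht₀ : t₀ ∈ Set.Ioo (0 : ℝ) 1)
    (h : t₀ ^ s + s * t₀ + 1 - s = 0) : (b s)⁻¹ = s / (s - 1) * t₀ := by
  rw [b, (isGreatest_inverse_ratio hs ht₀ h).csSup_eq, inv_inv]

end CoulombMeanField

theorem proposition4 :
    (∀ s : ℝ, 1 < s → s ≤ 3 →
      ∃ t₀ ∈ Set.Ioo (0 : ℝ) 1,
        -- `t₀` is the unique root in `(0, 1)`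
        (∀ t ∈ Set.Ioo (0 : ℝ) 1, t ^ s + s * t + 1 - s = 0 ↔ t = t₀) ∧
        -- the minimum exists and equals `s / (s - 1) * t₀`
        IsLeast ((fun t : ℝ => (1 + t ^ s) / (1 + t ^ (s - 1))) '' Set.Icc 0 1)
          (s / (s - 1) * t₀) ∧
        -- the maximum `b s` exists and is the reciprocal of that number
        IsGreatest ((fun t : ℝ => (1 + t ^ (s - 1)) / (1 + t ^ s)) '' Set.Icc 0 1)
          (CoulombMeanField.b s) ∧
        s / (s - 1) * t₀ = (CoulombMeanField.b s)⁻¹ ∧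
        -- the lower bound
        ENNReal.ofReal (s / (s - 1) * t₀) ≤ CoulombMeanField.beta s) ∧
    -- the two explicit values
    ((CoulombMeanField.b 2)⁻¹ = 2 * (√2 - 1) ∧
      ENNReal.ofReal (2 * (√2 - 1)) ≤ CoulombMeanField.beta 2) ∧
    ((CoulombMeanField.b 3)⁻¹ =
        3 / 2 * (((1 + √2) ^ (2 / 3 : ℝ) - 1) / (1 + √2) ^ (1 / 3 : ℝ)) ∧
      ENNReal.ofReal (3 / 2 * (((1 + √2) ^ (2 / 3 : ℝ) - 1) / (1 + √2) ^ (1 / 3 : ℝ))) ≤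
        CoulombMeanField.beta 3) := by
  open CoulombMeanField in
  refine ⟨fun s hs hs3 => ?_, ?_, ?_⟩
  · obtain ⟨t₀, ht₀, h⟩ := exists_root hs
    refine ⟨t₀, ht₀, fun t ht => ⟨fun h' => root_unique hs ht.1 ht₀.1 h' h, fun e => e ▸ h⟩,
      isLeast_ratio hs ht₀ h, ?_, (inv_b_eq hs ht₀ h).symm, root_value_le_beta hs hs3 ht₀.1 h⟩
    have hg := isGreatest_inverse_ratio hs ht₀ h
    rwa [b, hg.csSup_eq]
  · have e := inv_b_eq one_lt_two sqrt_two_sub_one_mem root_two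
    have l := root_value_le_beta one_lt_two (by norm_num) sqrt_two_sub_one_mem.1 root_two
    rw [show (2 : ℝ) / (2 - 1) = 2 by norm_num] at e l
    exact ⟨e, l⟩
  · obtain ⟨hmem, h⟩ := root_three_pos_and_eq rfl
    have e := inv_b_eq (by norm_num) hmem h
    have l := root_value_le_beta (by norm_num) le_rfl hmem.1 h
    rw [show (3 : ℝ) / (3 - 1) = 3 / 2 by norm_num] at e l
    exact ⟨e, l⟩
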